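/- A field extension $F \subseteq L$ is a radical extension if $L = F[\alpha]$ for some $\alpha \in L$ with $\alpha^n \in F$ for some positive integer $n$; it is a repeated radical extension if there are intermediate fields $F = L_0 \subseteq L_1 \subseteq \cdots \subseteq L_r = L$, with $r \ge 0$, such that each $L_i$ is a radical extension of $L_{i-1}$ for $0 < i \le r$. Theorem C. Let $Q$ be a subfield of the real numbers $\mathbb{R}$ and let $f \in Q[X]$ be irreducible of odd degree. Suppose that some root $\alpha$ of $f$ lies in a field $L$ with $Q \subseteq L \subseteq \mathbb{R}$ that is a repeated radical extension of $Q$. Then $\alpha$ is the only root of $f$ in $\mathbb{R}$. -/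

import Mathlib

/-- For subfields `F`, `L` of a field `E`, the field `L` is a radical extension of `F`:
`L = F(α)` for some `α` with `α ^ n ∈ F` for some positive integer `n`.
(The element `α` then lies in `L`, it is algebraic over `F`, so that `F(α) = F[α]`, and `F ≤ L`.) -/
def IsRadicalExtension {E : Type*} [Field E] (F L : Subfield E) : Prop :=
  ∃ α : E, (∃ n : ℕ, 0 < n ∧ α ^ n ∈ F) ∧
    (IntermediateField.adjoin F ({α} : Set E)).toSubfield = L

/-- For subfields `F`, `L` of a field `E`, the field `L` is a repeated radical extension of `F`:
there is a chain `F = K 0 ≤ K 1 ≤ ⋯ ≤ K r = L` in which each field is a radical extension of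
the one before. -/
def IsRepeatedRadicalExtension {E : Type*} [Field E] (F L : Subfield E) : Prop :=
  ∃ (r : ℕ) (K : Fin (r + 1) → Subfield E), K 0 = F ∧ K (Fin.last r) = L ∧
    ∀ i : Fin r, K i.castSucc ≤ K i.succ ∧ IsRadicalExtension (K i.castSucc) (K i.succ)

/-! Descend the chain from `L`, where `α` has a linear minimal polynomial, splitting each radical
step into prime ones. For `d ^ p ∈ F`, compare degrees in `F(α, d)`: `α` keeps odd degree over
`F(d)`, and each real conjugate of `α` over `F` remains one over `F(d)` (`of_prime_radical`). -/

open Polynomial IntermediateField in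
/-- A prime-degree radical `d` over a field `k` of real numbers has degree `p` unless it lies
in `k`, because its only possible real conjugates are `d` and `-d`. -/
theorem natDegree_minpoly_of_prime_pow_mem {k : Type*} [Field k] [Algebra k ℝ] {p : ℕ}
    (hp : p.Prime) {d : ℝ} {c : k} (hc : d ^ p = algebraMap k ℝ c)
    (hd : d ∉ (algebraMap k ℝ).range) : (minpoly k d).natDegree = p := by
  have hirr : Irreducible (X ^ p - C c) := by
    refine X_pow_sub_C_irreducible_of_prime hp fun b hb => hd ?_
    have h : algebraMap k ℝ b ^ p = d ^ p := by rw [hc, ← hb, map_pow]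
    have habs : |algebraMap k ℝ b| = |d| :=
      (pow_left_inj₀ (abs_nonneg _) (abs_nonneg _) hp.ne_zero).1 (by rw [← abs_pow, ← abs_pow, h])
    rcases abs_eq_abs.1 habs with h | h
    · exact ⟨b, h⟩
    · exact ⟨-b, by rw [map_neg, h, neg_neg]⟩
  rw [← minpoly.eq_of_irreducible_of_monic hirr (by simp [hc])
    (monic_X_pow_sub_C c hp.ne_zero), natDegree_X_pow_sub_C]

open IntermediateField in
/-- The two towers from `k` to `k(a, d)` yield the same product of degrees. -/
theorem natDegree_minpoly_mul_comm {k E : Type*} [Field k] [Field E] [Algebra k E] {a d : E}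
    (ha : IsIntegral k a) (hd : IsIntegral k d) :
    (minpoly k a).natDegree * (minpoly k⟮a⟯ d).natDegree =
      (minpoly k d).natDegree * (minpoly k⟮d⟯ a).natDegree := by
  rw [← adjoin.finrank ha, ← adjoin.finrank hd, ← adjoin.finrank (ha.tower_top (A := k⟮d⟯)),
    ← adjoin.finrank (hd.tower_top (A := k⟮a⟯)), Module.finrank_mul_finrank,
    Module.finrank_mul_finrank]
  exact congrArg (fun K : IntermediateField k E => Module.finrank k K)
    (adjoin_simple_comm k a d)

open Polynomial IntermediateField in
/-- If `α` has odd degree over `F`, then it has no other real conjugate over `F`. -/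
def OddDegreeUniqueRealRoot (F : Subfield ℝ) (α : ℝ) : Prop :=
  IsIntegral F α → Odd (minpoly F α).natDegree → ∀ β : ℝ, aeval β (minpoly F α) = 0 → β = α

open Polynomial IntermediateField in
theorem OddDegreeUniqueRealRoot.of_prime_radical {F : Subfield ℝ} {α d : ℝ} {p : ℕ}
    (hp : p.Prime) (hd : d ^ p ∈ F) (h : OddDegreeUniqueRealRoot F⟮d⟯.toSubfield α) :
    OddDegreeUniqueRealRoot F α := by
  intro hα hodd β hβ
  have hdF : IsIntegral F d := .of_pow hp.pos (isIntegral_algebraMap (x := (⟨_, hd⟩ : F)))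
  have hmul := natDegree_minpoly_mul_comm hα hdF
  have hαK : IsIntegral F⟮d⟯ α := hα.tower_top
  by_cases hdα : d ∈ F⟮α⟯
  · have hle : F⟮d⟯ ≤ F⟮α⟯ := adjoin_simple_le_iff.2 hdα
    have hoddmul : Odd ((minpoly F d).natDegree * (minpoly F⟮d⟯ α).natDegree) := by
      have h1 : (minpoly F⟮α⟯ d).natDegree = 1 :=
        minpoly.natDegree_eq_one_iff.2 ⟨⟨d, hdα⟩, rfl⟩
      rwa [← hmul, h1, mul_one]
    rw [Nat.odd_mul] at hoddmul
    refine h hαK hoddmul.2 β ?_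
    let σ : F⟮α⟯ →ₐ[F] ℝ := (algHomAdjoinIntegralEquiv F hα).symm
      ⟨β, mem_aroots.2 ⟨minpoly.ne_zero hα, hβ⟩⟩
    have hσ : σ (AdjoinSimple.gen F α) = β := algHomAdjoinIntegralEquiv_symm_apply_gen F hα _
    -- If `d ∉ F`, its degree `p` divides the odd degree of `α`, so `p` is odd and `d` is the only
    -- real `p`-th root of `d ^ p`.
    have hσd : σ ⟨d, hdα⟩ = d := by
      by_cases hdF' : d ∈ (algebraMap F ℝ).range
      · obtain ⟨x, hx⟩ := hdF'
        have : (⟨d, hdα⟩ : F⟮α⟯) = algebraMap F F⟮α⟯ x := Subtype.ext hx.symm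
        rw [this, σ.commutes, hx]
      · have hpodd : Odd p := by
          rw [← natDegree_minpoly_of_prime_pow_mem hp (c := (⟨_, hd⟩ : F)) rfl hdF']
          exact hoddmul.1
        refine hpodd.strictMono_pow.injective ?_
        have : (⟨d, hdα⟩ : F⟮α⟯) ^ p = algebraMap F F⟮α⟯ ⟨_, hd⟩ := rfl
        change σ ⟨d, hdα⟩ ^ p = d ^ p
        rw [← map_pow, this, σ.commutes]
        rfl
    have hσK : σ.comp (inclusion hle) = F⟮d⟯.val :=
      algHom_ext_of_eq_adjoin _ rfl (by rintro x rfl; exact hσd)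
    -- Since `σ` fixes `F(d)`, it carries this relation for `α` to the same one for `β`.
    have hgen : eval₂ (inclusion hle : F⟮d⟯ →+* F⟮α⟯) (AdjoinSimple.gen F α)
        (minpoly F⟮d⟯ α) = 0 := by
      refine Subtype.val_injective ?_
      change F⟮α⟯.val.toRingHom _ = _
      rw [hom_eval₂]
      exact minpoly.aeval F⟮d⟯ α
    have := congrArg (σ : F⟮α⟯ →+* ℝ) hgen
    rw [hom_eval₂, map_zero] at this
    have hcomp : (σ : F⟮α⟯ →+* ℝ).comp (inclusion hle : F⟮d⟯ →+* F⟮α⟯) = algebraMap F⟮d⟯ ℝ :=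
      congrArg (fun τ : F⟮d⟯ →ₐ[F] ℝ => (τ : F⟮d⟯ →+* ℝ)) hσK
    rw [hcomp] at this
    erw [hσ] at this
    exact this
  · have hrange : d ∉ (algebraMap F⟮α⟯ ℝ).range := by
      rintro ⟨x, rfl⟩
      exact hdα x.2
    have hrangeF : d ∉ (algebraMap F ℝ).range := by
      rintro ⟨x, rfl⟩
      exact hdα (IntermediateField.algebraMap_mem _ x)
    -- Here `d` has degree `p` over both `F` and `F(α)`, so the minimal polynomial of `α` is
    -- unchanged over `F(d)`.
    rw [natDegree_minpoly_of_prime_pow_mem hp (c := algebraMap F F⟮α⟯ ⟨_, hd⟩) rfl hrange,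
      natDegree_minpoly_of_prime_pow_mem hp (c := (⟨_, hd⟩ : F)) rfl hrangeF, mul_comm] at hmul
    have hdeg := Nat.eq_of_mul_eq_mul_left hp.pos hmul
    have heq : (minpoly F α).map (algebraMap F F⟮d⟯) = minpoly F⟮d⟯ α :=
      eq_of_monic_of_dvd_of_natDegree_le (minpoly.monic hαK)
        ((minpoly.monic hα).map _) (minpoly.dvd_map_of_isScalarTower F F⟮d⟯ α)
        (by rw [natDegree_map, hdeg])
    refine h hαK (hdeg ▸ hodd : Odd (minpoly F⟮d⟯ α).natDegree) β ?_
    change aeval β (minpoly F⟮d⟯ α) = 0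
    rw [← heq, aeval_map_algebraMap, hβ]

open IntermediateField in
theorem OddDegreeUniqueRealRoot.of_radical {α c : ℝ} {n : ℕ} (hn : n ≠ 0) {F : Subfield ℝ}
    (hc : c ^ n ∈ F) (h : OddDegreeUniqueRealRoot F⟮c⟯.toSubfield α) :
    OddDegreeUniqueRealRoot F α := by
  induction n using Nat.recOnMul generalizing F c with
  | zero => exact absurd rfl hn
  | one =>
    have : F⟮c⟯.toSubfield = F := by
      have hbot : F⟮c⟯ = ⊥ := adjoin_simple_eq_bot_iff.2 ⟨⟨c, by simpa using hc⟩, rfl⟩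
      rw [hbot, bot_toSubfield]
      exact F.fieldRange_subtype
    rwa [this] at h
  | prime p hp => exact h.of_prime_radical hp hc
  | mul a b iha ihb =>
    have ha : a ≠ 0 := left_ne_zero_of_mul hn
    have hb : b ≠ 0 := right_ne_zero_of_mul hn
    -- Insert `F(c ^ b)` between `F` and `F(c)`: an `a`-th root, then a `b`-th root.
    refine iha ha (c := c ^ b) (by rwa [← pow_mul, mul_comm]) ?_
    refine ihb hb (c := c) (mem_adjoin_simple_self F (c ^ b)) ?_
    have hmem : c ^ b ∈ F⟮c⟯ := pow_mem (mem_adjoin_simple_self F c) b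
    have : (F⟮c ^ b⟯⟮c⟯).restrictScalars F = F⟮c⟯ := by
      rw [adjoin_simple_adjoin_simple]
      refine le_antisymm (adjoin_le_iff.2 ?_) (adjoin.mono _ _ _ (by simp))
      exact Set.insert_subset hmem (Set.singleton_subset_iff.2 (mem_adjoin_simple_self F c))
    have heq : (adjoin F⟮c ^ b⟯.toSubfield {c}).toSubfield = F⟮c⟯.toSubfield :=
      congrArg IntermediateField.toSubfield this
    rwa [heq]

open Polynomial in
theorem IsRepeatedRadicalExtension.oddDegreeUniqueRealRoot {Q L : Subfield ℝ}
    (hL : IsRepeatedRadicalExtension Q L) {α : ℝ} (hα : α ∈ L) :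
    OddDegreeUniqueRealRoot Q α := by
  obtain ⟨r, K, rfl, rfl, hK⟩ := hL
  suffices h : ∀ i, OddDegreeUniqueRealRoot (K i) α from h 0
  intro i
  induction i using Fin.reverseInduction with
  | last =>
    intro _ _ β hβ
    rw [show minpoly (K (Fin.last r)) α = X - C ⟨α, hα⟩ from
      minpoly.eq_X_sub_C ℝ (⟨α, hα⟩ : K (Fin.last r))] at hβ
    rw [map_sub, aeval_X, aeval_C] at hβ
    exact sub_eq_zero.1 hβ
  | cast i ih =>
    obtain ⟨-, c, ⟨n, hn, hc⟩, hKc⟩ := hK i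
    exact .of_radical hn.ne' hc (by rwa [hKc])

theorem theoremC (Q : Subfield ℝ) (f : Polynomial Q) (hf : Irreducible f)
    (hodd : Odd f.natDegree) (L : Subfield ℝ) (hL : IsRepeatedRadicalExtension Q L)
    (α : ℝ) (hαL : α ∈ L) (hα : Polynomial.aeval α f = 0) :
    ∀ β : ℝ, Polynomial.aeval β f = 0 → β = α := by
  intro β hβ
  have hint : IsIntegral Q α := isAlgebraic_iff_isIntegral.1 ⟨f, hf.ne_zero, hα⟩
  have hmin := minpoly.eq_of_irreducible hf hα
  refine hL.oddDegreeUniqueRealRoot hαL hint ?_ β ?_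
  · rwa [← hmin, Polynomial.natDegree_mul_C (inv_ne_zero (by simpa using hf.ne_zero))]
  · rw [← hmin, map_mul, hβ, zero_mul]
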